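/- **Theorem.** Let $\Box$ be the box category with (maximum) connections: its objects are the posets $[1]^n$, $n\ge 0$, and its morphisms are the monotone maps generated under composition by the faces $\partial_{i,\varepsilon}\colon[1]^{n-1}\to[1]^n$ (insert $\varepsilon\in\{0,1\}$ as the $i$-th coordinate), the degeneracies $\sigma_i\colon[1]^n\to[1]^{n-1}$ (forget the $i$-th coordinate) and the connections $\gamma_i\colon[1]^n\to[1]^{n-1}$ (replace $x_i,x_{i+1}$ by $\max\{x_i,x_{i+1}\}$). Let $\mathsf{cSet}$ be the category of presheaves of sets on $\Box$, let $\Box^n$ be the presheaf represented by $[1]^n$, and let $\mathsf{sSet}$ be the category of simplicial sets. For $n\ge 0$ let $Q^n$ be the quotient of $\Box^n$ by the relation that identifies two $m$-cubes $(f_1,\dots,f_n),(g_1,\dots,g_n)\colon[1]^m\to[1]^n$ if they are equal or if there is $j\le n$ with $f_i=g_i$ for all $i<j$ and $f_j=g_j=\mathrm{const}_1$. The $Q^n$ form a cosimplicial object $Q^\bullet\colon\Delta\to\mathsf{cSet}$, in which the faces $Q^{n-1}\to Q^n$ are induced by $\partial_{n,1}$ (the $0$-th face) and $\partial_{n-j+1,0}$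 (the $j$-th face, $1\le j\le n$), and the degeneracies $Q^n\to Q^{n-1}$ are induced by $\sigma_n$ (the $0$-th degeneracy) and $\gamma_{n-j}$ (the $j$-th degeneracy, $1\le j\le n-1$). Let $\mathrm Q\colon\mathsf{sSet}\to\mathsf{cSet}$ be the left Kan extension of $Q^\bullet$ along the Yoneda embedding $\Delta\hookrightarrow\mathsf{sSet}$, and let $\int\colon\mathsf{cSet}\to\mathsf{sSet}$ be the functor with $(\int X)_n=\mathsf{cSet}(Q^n,X)$. Then $\mathrm Q$ is left adjoint to $\int$, through the adjunction whose unit $\eta_X\colon X\to\int\mathrm QX$ sends an $n$-simplex $x\colon\Delta^n\to X$ to the composite $Q^n\to\mathrm Q\Delta^n\xrightarrow{\mathrm Qx}\mathrm QX$, where $Q^n\to\mathrm Q\Delta^n$ is the canonical map of the Kan extension. This unit is an isomorphism for every simplicial set $X$, and $\mathrm Q$ is full and faithful. In other words, $\mathrm Q\dashv\int$ exhibits $\mathsf{sSet}$ as a co-reflective subcategory of $\mathsf{cSet}$. -/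

import Mathlib

open CategoryTheory Opposite

universe u

namespace CubicalCoreflection

/-! ### The box category with connections -/

/-- The poset `[1]^n`, where `[1] = {0 < 1}` is `Bool` with `false < true`. -/
abbrev Cube (n : ℕ) : Type := Fin n → Bool

/-- The face map `[1]^n → [1]^(n+1)` that inserts the constant `ε` at position `i`. -/
def face {n : ℕ} (i : Fin (n + 1)) (ε : Bool) : Cube n →o Cube (n + 1) where
  toFun x := i.insertNth ε x
  monotone' x y h := by
    intro k
    induction k using Fin.succAboveCases i with
    | x => simp
    | p k => simpa using h k

/-- The degeneracy `[1]^(n+1) → [1]^n` that forgets the coordinate at position `i`. -/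
def degeneracy {n : ℕ} (i : Fin (n + 1)) : Cube (n + 1) →o Cube n where
  toFun x := i.removeNth x
  monotone' _ _ h k := h (i.succAbove k)

/-- The connection `[1]^(n+1) → [1]^n` that replaces the adjacent coordinates at positions `i`
and `i + 1` by their maximum. -/
def connection {n : ℕ} (i : Fin n) : Cube (n + 1) →o Cube n where
  toFun x k := if k < i then x k.castSucc
    else if k = i then max (x k.castSucc) (x k.succ) else x k.succ
  monotone' x y h k := by
    dsimp only
    split_ifs
    · exact h _
    · exact max_le_max (h _) (h _)
    · exact h _

/-- The monotone maps `[1]^m → [1]^n` that are generated under composition by faces, degeneracies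
and (maximum) connections. -/
inductive IsBoxMap : ∀ {m n : ℕ}, (Cube m →o Cube n) → Prop
  | id (n : ℕ) : IsBoxMap (OrderHom.id : Cube n →o Cube n)
  | face {n : ℕ} (i : Fin (n + 1)) (ε : Bool) : IsBoxMap (face i ε)
  | degeneracy {n : ℕ} (i : Fin (n + 1)) : IsBoxMap (degeneracy i)
  | connection {n : ℕ} (i : Fin n) : IsBoxMap (connection i)
  | comp {l m n : ℕ} {g : Cube m →o Cube n} {f : Cube l →o Cube m} :
      IsBoxMap g → IsBoxMap f → IsBoxMap (g.comp f)

/-- The objects of the box category; `⟨n⟩` stands for the poset `[1]^n`. -/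
structure Box : Type where
  /-- the dimension -/
  dim : ℕ

/-- A morphism of the box category. -/
@[ext]
structure Box.Hom (a b : Box) : Type where
  /-- the underlying monotone map -/
  map : Cube a.dim →o Cube b.dim
  /-- the underlying map is generated by faces, degeneracies and connections -/
  isBoxMap : IsBoxMap map

/-- The box category with connections. -/
instance : Category Box where
  Hom := Box.Hom
  id a := ⟨OrderHom.id, .id a.dim⟩
  comp f g := ⟨g.map.comp f.map, .comp g.isBoxMap f.isBoxMap⟩

@[ext]
lemma Box.hom_ext {a b : Box} {f g : a ⟶ b} (h : f.map = g.map) : f = g :=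
  Box.Hom.ext h

@[simp] lemma Box.id_map (a : Box) : Box.Hom.map (𝟙 a) = OrderHom.id := rfl

@[simp] lemma Box.comp_map {a b c : Box} (f : a ⟶ b) (g : b ⟶ c) :
    (f ≫ g).map = g.map.comp f.map := rfl

/-- Cubical sets (with connections): presheaves on the box category. -/
abbrev CSet : Type (u + 1) := Boxᵒᵖ ⥤ Type u

/-! ### The cubical sets `Q^n` -/

/-- The relation on the `a`-cubes of the representable cubical set `□^b`: two cubes
`f = (f_1, …, f_n)` and `g = (g_1, …, g_n)` are related if they are equal, or if for some `j` we
have `f_i = g_i` for all `i < j`, and both `f_j` and `g_j` are constant with value `1`. -/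
def QRel {a b : Box} (f g : a ⟶ b) : Prop :=
  f = g ∨ ∃ j : Fin b.dim, (∀ i < j, ∀ x, f.map x i = g.map x i) ∧
    (∀ x, f.map x j = true) ∧ (∀ x, g.map x j = true)

lemma QRel.equivalence (a b : Box) : Equivalence (QRel (a := a) (b := b)) where
  refl f := Or.inl rfl
  symm := by
    rintro f g (rfl | ⟨j, h, hf, hg⟩)
    · exact Or.inl rfl
    · exact Or.inr ⟨j, fun i hi x => (h i hi x).symm, hg, hf⟩
  trans := by
    rintro f g h (rfl | ⟨j, e, hf, hg⟩) (rfl | ⟨j', e', hg', hh⟩)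
    · exact Or.inl rfl
    · exact Or.inr ⟨j', e', hg', hh⟩
    · exact Or.inr ⟨j, e, hf, hg⟩
    · rcases lt_trichotomy j j' with hj | rfl | hj
      · exact Or.inr ⟨j, fun i hi x => (e i hi x).trans (e' i (hi.trans hj) x), hf,
          fun x => (e' j hj x).symm.trans (hg x)⟩
      · exact Or.inr ⟨j, fun i hi x => (e i hi x).trans (e' i hi x), hf, hh⟩
      · exact Or.inr ⟨j', fun i hi x => (e i (hi.trans hj) x).trans (e' i hi x),
          fun x => (e j' hj x).trans (hg' x), hh⟩

/-- The relation `QRel` as a setoid. -/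
def qSetoid (a b : Box) : Setoid (a ⟶ b) := ⟨QRel, QRel.equivalence a b⟩

lemma QRel.precomp {a b c : Box} (h : a ⟶ b) {f g : b ⟶ c} (hfg : QRel f g) :
    QRel (h ≫ f) (h ≫ g) := by
  rcases hfg with rfl | ⟨j, e, hf, hg⟩
  · exact Or.inl rfl
  · exact Or.inr ⟨j, fun i hi x => e i hi _, fun x => hf _, fun x => hg _⟩

/-- The cubical set `Q^n`, the quotient of the representable cubical set `□^n` by `QRel`. -/
def qObj (n : ℕ) : CSet.{u} where
  obj a := ULift.{u} (Quotient (qSetoid a.unop ⟨n⟩))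
  map h := ↾fun z => ⟨Quotient.map (fun f => h.unop ≫ f) (fun _ _ r => QRel.precomp h.unop r) z.down⟩
  map_id a := by
    ext ⟨z⟩
    induction z using Quotient.inductionOn
    rfl
  map_comp h k := by
    ext ⟨z⟩
    induction z using Quotient.inductionOn
    rfl

/-- The quotient map `π_n : □^n ⟶ Q^n`. -/
def qProj (n : ℕ) : uliftYoneda.{u}.obj (⟨n⟩ : Box) ⟶ qObj.{u} n where
  app a := ↾fun f => ⟨Quotient.mk (qSetoid a.unop ⟨n⟩) f.down⟩

/-! ### The cosimplicial structure

The coordinates of `[1]^n`, read from the last to the first, are indexed by the vertices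
`1, …, n` of `[n]`. -/

/-- The coordinate of `x` belonging to the vertex `v` of `[n]`; by convention it is `1` for the
vertex `0`. -/
def coord {n : ℕ} (x : Cube n) : Fin (n + 1) → Bool :=
  Fin.cases true fun v => x v.rev

@[simp] lemma coord_zero {n : ℕ} (x : Cube n) : coord x 0 = true := rfl

@[simp] lemma coord_succ {n : ℕ} (x : Cube n) (v : Fin n) : coord x v.succ = x v.rev := rfl

/-- The map of cubes attached to a monotone map `φ : [m] → [n]`: the coordinate of the image of `x`
at a vertex `v ≥ 1` is the maximum of the coordinates of `x` at the vertices in the fibre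
of `φ` over `v` (the maximum of the empty set being `0`). -/
def pushCube {m n : ℕ} (φ : Fin (m + 1) →o Fin (n + 1)) : Cube m →o Cube n where
  toFun x k := decide (∃ u, φ u = k.rev.succ ∧ coord x u = true)
  monotone' x y h k := by
    rw [Bool.le_iff_imp]
    simp only [decide_eq_true_eq]
    rintro ⟨u, hu, hx⟩
    refine ⟨u, hu, ?_⟩
    induction u using Fin.cases with
    | zero => rfl
    | succ u => exact Bool.le_iff_imp.1 (h u.rev) hx

lemma pushCube_apply {m n : ℕ} (φ : Fin (m + 1) →o Fin (n + 1)) (x : Cube m) (k : Fin n) :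
    pushCube φ x k = true ↔ ∃ u, φ u = k.rev.succ ∧ coord x u = true := by
  exact decide_eq_true_iff

lemma coord_pushCube {m n : ℕ} (φ : Fin (m + 1) →o Fin (n + 1)) (x : Cube m) {v : Fin (n + 1)}
    (hv : v ≠ 0) : coord (pushCube φ x) v = true ↔ ∃ u, φ u = v ∧ coord x u = true := by
  obtain ⟨v, rfl⟩ := Fin.exists_succ_eq.2 hv
  rw [coord_succ, pushCube_apply, Fin.rev_rev]

lemma face_apply {n : ℕ} (i : Fin (n + 1)) (ε : Bool) (x : Cube n) (k : Fin (n + 1)) :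
    face i ε x k = i.insertNth (α := fun _ => Bool) ε x k := rfl

lemma degeneracy_apply {n : ℕ} (i : Fin (n + 1)) (x : Cube (n + 1)) (k : Fin n) :
    degeneracy i x k = x (i.succAbove k) := rfl

lemma connection_apply {n : ℕ} (i : Fin n) (x : Cube (n + 1)) (k : Fin n) :
    connection i x k = true ↔ ∃ w, i.predAbove w = k ∧ x w = true := by
  change (if k < i then x k.castSucc
    else if k = i then max (x k.castSucc) (x k.succ) else x k.succ) = true ↔ _
  have key : ∀ w : Fin (n + 1), i.predAbove w = k ↔
      (k ≤ i ∧ w = k.castSucc) ∨ (i ≤ k ∧ w = k.succ) := by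
    intro w
    unfold Fin.predAbove
    split_ifs with h <;> simp only [Fin.lt_def, Fin.le_def, Fin.ext_iff, Fin.val_castSucc,
      Fin.val_succ, Fin.val_pred, Fin.coe_castPred] at h ⊢ <;> omega
  simp only [key]
  rcases lt_trichotomy k i with h | rfl | h
  · simp [h, h.le, not_le.2 h]
  · simp [or_and_right, exists_or]
  · simp [h.not_gt, h.ne', h.le, not_le.2 h]

/-- The `0`-th face map of simplices corresponds to the last positive face map of cubes. -/
lemma pushCube_δ_zero (n : ℕ) :
    pushCube (SimplexCategory.δ (0 : Fin (n + 2))).toOrderHom = face (Fin.last n) true := by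
  ext x k
  rw [Bool.eq_iff_iff, pushCube_apply, face_apply]
  change (∃ u, Fin.succAbove 0 u = _ ∧ _) ↔ _
  induction k using Fin.succAboveCases (Fin.last n) with
  | x => simpa using ⟨0, by simp, rfl⟩
  | p k =>
    rw [Fin.insertNth_apply_succAbove, Fin.succAbove_last, Fin.rev_castSucc]
    simp

/-- The `(i+1)`-st face map of simplices corresponds to the negative face map of cubes at the
`i`-th position from the end. -/
lemma pushCube_δ_succ {n : ℕ} (i : Fin (n + 1)) :
    pushCube (SimplexCategory.δ i.succ).toOrderHom = face i.rev false := by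
  ext x k
  rw [Bool.eq_iff_iff, pushCube_apply, face_apply]
  change (∃ u, Fin.succAbove i.succ u = _ ∧ _) ↔ _
  induction k using Fin.succAboveCases i.rev with
  | x => simp [Fin.succAbove_ne]
  | p k =>
    rw [Fin.insertNth_apply_succAbove, Fin.rev_succAbove, Fin.rev_rev, ← Fin.succ_succAbove_succ]
    simp only [Fin.succAbove_right_inj, exists_eq_left, coord_succ, Fin.rev_rev]

/-- The `0`-th degeneracy map of simplices corresponds to the last degeneracy of cubes. -/
lemma pushCube_σ_zero (n : ℕ) :
    pushCube (SimplexCategory.σ (0 : Fin (n + 1))).toOrderHom = degeneracy (Fin.last n) := by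
  ext x k
  rw [Bool.eq_iff_iff, pushCube_apply, degeneracy_apply]
  change (∃ u, Fin.predAbove 0 u = _ ∧ _) ↔ _
  rw [Fin.exists_fin_succ, Fin.predAbove_right_zero]
  simp only [Fin.predAbove_zero_succ, coord_succ, exists_eq_left, (Fin.succ_ne_zero _).symm,
    false_and, false_or, Fin.rev_succ, Fin.rev_rev, Fin.succAbove_last]

/-- The `(i+1)`-st degeneracy map of simplices corresponds to the connection of cubes at the
`i`-th position from the end. -/
lemma pushCube_σ_succ {n : ℕ} (i : Fin n) :
    pushCube (SimplexCategory.σ i.succ).toOrderHom = connection i.rev := by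
  ext x k
  rw [Bool.eq_iff_iff, pushCube_apply, connection_apply]
  change (∃ u, Fin.predAbove i.succ u = _ ∧ _) ↔ _
  rw [Fin.exists_fin_succ]
  rw [Fin.predAbove_right_zero]
  simp only [Fin.succ_predAbove_succ, coord_succ, Fin.succ_inj, (Fin.succ_ne_zero _).symm,
    false_and, false_or]
  refine Fin.revPerm.exists_congr fun v => and_congr_left fun _ => ?_
  rw [Fin.revPerm_apply, ← Fin.rev_predAbove, Fin.rev_eq_iff]

lemma pushCube_id (n : ℕ) : pushCube (OrderHom.id : Fin (n + 1) →o Fin (n + 1)) = OrderHom.id := by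
  ext x k
  rw [Bool.eq_iff_iff, pushCube_apply]
  simp

lemma coord_pushCube_comp {l m n : ℕ} (ψ : Fin (m + 1) →o Fin (n + 1))
    (φ : Fin (l + 1) →o Fin (m + 1)) (x : Cube l) {w : Fin (n + 1)} (hw : w ≠ 0)
    (h : φ 0 = 0 ∨ ψ 0 = 0 ∨ ψ (φ 0) ≤ w) :
    coord (pushCube (ψ.comp φ) x) w = true ↔ coord (pushCube ψ (pushCube φ x)) w = true := by
  rw [coord_pushCube _ _ hw, coord_pushCube _ _ hw]
  constructor
  · rintro ⟨u, hu, hx⟩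
    refine ⟨φ u, hu, ?_⟩
    by_cases hv : φ u = 0
    · rw [hv]; rfl
    · exact (coord_pushCube _ _ hv).2 ⟨u, rfl, hx⟩
  · rintro ⟨v, rfl, hx⟩
    by_cases hv : v = 0
    · subst hv
      rcases h with h | h | h
      · exact ⟨0, congrArg ψ h, rfl⟩
      · exact absurd h hw
      · exact ⟨0, le_antisymm h (ψ.monotone (Fin.zero_le _)), rfl⟩
    · obtain ⟨u, hu, hx⟩ := (coord_pushCube _ _ hv).1 hx
      exact ⟨u, congrArg ψ hu, hx⟩

lemma cube_ext {n : ℕ} {x y : Cube n} (h : ∀ v ≠ 0, coord x v = true ↔ coord y v = true) :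
    x = y := by
  funext k
  have := h k.rev.succ (Fin.succ_ne_zero _)
  rwa [coord_succ, coord_succ, Fin.rev_rev, ← Bool.eq_iff_iff] at this

lemma pushCube_comp {l m n : ℕ} (ψ : Fin (m + 1) →o Fin (n + 1))
    (φ : Fin (l + 1) →o Fin (m + 1)) (h : φ 0 = 0 ∨ ψ 0 = 0) :
    pushCube (ψ.comp φ) = (pushCube ψ).comp (pushCube φ) := by
  refine OrderHom.ext _ _ (funext fun x => cube_ext fun w hw => ?_)
  exact coord_pushCube_comp ψ φ x hw (by tauto)

lemma isBoxMap_pushCube_δ {n : ℕ} (i : Fin (n + 2)) :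
    IsBoxMap (pushCube (SimplexCategory.δ i).toOrderHom) := by
  induction i using Fin.cases with
  | zero => rw [pushCube_δ_zero]; exact .face _ _
  | succ i => rw [pushCube_δ_succ]; exact .face _ _

lemma isBoxMap_pushCube_σ {n : ℕ} (i : Fin (n + 1)) :
    IsBoxMap (pushCube (SimplexCategory.σ i).toOrderHom) := by
  induction i using Fin.cases with
  | zero => rw [pushCube_σ_zero]; exact .degeneracy _
  | succ i => rw [pushCube_σ_succ]; exact .connection _

open SimplexCategory Simplicial in
lemma isBoxMap_pushCube {m n : ℕ} (φ : ⦋m⦌ ⟶ ⦋n⦌) : IsBoxMap (pushCube φ.toOrderHom) := by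
  induction hN : m + n using Nat.strong_induction_on generalizing m n with
  | h N ih =>
  subst hN
  by_cases hi : Function.Injective φ.toOrderHom
  · by_cases hs : ∀ j : Fin (n + 1), j ≠ 0 → ∃ u, φ.toOrderHom u = j
    · by_cases h0 : ∃ u, φ.toOrderHom u = 0
      · have hb : Function.Bijective φ.toOrderHom :=
          ⟨hi, fun j => if hj : j = 0 then hj ▸ h0 else hs j hj⟩
        obtain rfl : m = n := by simpa using Fintype.card_of_bijective hb
        have := SimplexCategory.isIso_of_bijective hb
        rw [SimplexCategory.eq_id_of_isIso φ]
        exact pushCube_id m ▸ .id m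
      · obtain _ | n := n
        · exact absurd ⟨0, Subsingleton.elim (α := Fin 1) _ _⟩ h0
        obtain ⟨θ, rfl⟩ := eq_comp_δ_of_not_surjective' φ 0 (not_exists.1 h0)
        have hb : Function.Bijective θ.toOrderHom := by
          refine ⟨fun a b h => hi (congrArg (δ (0 : Fin (n + 2))).toOrderHom h), fun j => ?_⟩
          obtain ⟨u, hu⟩ := hs j.succ (Fin.succ_ne_zero _)
          exact ⟨u, Fin.succ_injective _ hu⟩
        obtain rfl : m = n := by simpa using Fintype.card_of_bijective hb
        have := SimplexCategory.isIso_of_bijective hb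
        rw [SimplexCategory.eq_id_of_isIso θ, Category.id_comp]
        exact isBoxMap_pushCube_δ 0
    · push Not at hs
      obtain ⟨j, hj, hu⟩ := hs
      obtain _ | n := n
      · exact absurd (Subsingleton.elim (α := Fin 1) _ _) hj
      obtain ⟨θ, rfl⟩ := eq_comp_δ_of_not_surjective' φ j hu
      rw [comp_toOrderHom, pushCube_comp _ _ (Or.inr (Fin.succAbove_ne_zero_zero hj))]
      exact .comp (isBoxMap_pushCube_δ j) (ih _ (by omega) θ rfl)
  · obtain _ | m := m
    · exact absurd (Function.injective_of_subsingleton (α := Fin 1) _) hi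
    obtain ⟨i, θ, rfl⟩ := eq_σ_comp_of_not_injective φ hi
    rw [comp_toOrderHom, pushCube_comp _ _ (Or.inl (Fin.predAbove_right_zero (i := i)))]
    exact .comp (ih _ (by omega) θ rfl) (isBoxMap_pushCube_σ i)

/-- The map `[1]^m → [1]^n` of the box category attached to a map `[m] → [n]` of the simplex
category. -/
def boxMap {X Y : SimplexCategory} (φ : X ⟶ Y) : (⟨X.len⟩ : Box) ⟶ ⟨Y.len⟩ :=
  ⟨pushCube φ.toOrderHom, isBoxMap_pushCube φ⟩

lemma QRel.of_coord {a : Box} {n : ℕ} {f g : a ⟶ ⟨n⟩} (w : Fin (n + 1))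
    (h : ∀ v, w < v → ∀ x, coord (f.map x) v = true ↔ coord (g.map x) v = true)
    (hf : ∀ x, coord (f.map x) w = true) (hg : ∀ x, coord (g.map x) w = true) : QRel f g := by
  induction w using Fin.cases with
  | zero =>
    refine Or.inl (Box.hom_ext (OrderHom.ext _ _ (funext fun x => cube_ext fun v hv => ?_)))
    exact h v (Fin.pos_of_ne_zero hv) x
  | succ w =>
    refine Or.inr ⟨w.rev, fun i hi x => ?_, hf, hg⟩
    have := h i.rev.succ (Fin.succ_lt_succ_iff.2 (Fin.lt_rev_iff.1 hi)) x
    rwa [coord_succ, coord_succ, Fin.rev_rev, ← Bool.eq_iff_iff] at this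

lemma QRel.postcomp {a : Box} {X Y : SimplexCategory} (φ : X ⟶ Y) {f g : a ⟶ ⟨X.len⟩}
    (h : QRel f g) : QRel (f ≫ boxMap φ) (g ≫ boxMap φ) := by
  rcases h with rfl | ⟨j, e, hf, hg⟩
  · exact Or.inl rfl
  have e' : ∀ u, j.rev.succ ≤ u → ∀ x, coord (f.map x) u = coord (g.map x) u := by
    intro u hu x
    induction u using Fin.cases with
    | zero => rfl
    | succ u =>
      rcases eq_or_lt_of_le (Fin.succ_le_succ_iff.1 hu) with rfl | hu
      · simp [hf, hg]
      · exact e _ (Fin.rev_lt_iff.1 hu) x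
  have hw : ∀ h : a ⟶ ⟨X.len⟩, (∀ x, h.map x j = true) → ∀ x,
      coord ((h ≫ boxMap φ).map x) (φ.toOrderHom j.rev.succ) = true := by
    intro h hh x
    by_cases h0 : φ.toOrderHom j.rev.succ = 0
    · rw [h0]; rfl
    · exact (coord_pushCube _ _ h0).2 ⟨_, rfl, by simpa using hh x⟩
  refine QRel.of_coord (φ.toOrderHom j.rev.succ) (fun v hv x => ?_) (hw f hf) (hw g hg)
  have h0 : v ≠ 0 := (lt_of_le_of_lt (Fin.zero_le _) hv).ne'
  refine (coord_pushCube _ _ h0).trans (Iff.trans ?_ (coord_pushCube _ _ h0).symm)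
  refine exists_congr fun u => and_congr_right fun hu => ?_
  rw [e' u]
  by_contra hlt
  exact absurd (φ.toOrderHom.monotone (le_of_not_ge hlt)) (not_le.2 (hu ▸ hv))

lemma QRel.comp {a : Box} {X Y Z : SimplexCategory} (φ : X ⟶ Y) (ψ : Y ⟶ Z) (f : a ⟶ ⟨X.len⟩) :
    QRel (f ≫ boxMap (φ ≫ ψ)) ((f ≫ boxMap φ) ≫ boxMap ψ) := by
  have h0 : ∀ w, ψ.toOrderHom (φ.toOrderHom 0) ≤ w → ∀ x,
      coord ((f ≫ boxMap (φ ≫ ψ)).map x) w = true ↔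
        coord (((f ≫ boxMap φ) ≫ boxMap ψ).map x) w = true := by
    intro w hw x
    by_cases h0 : w = 0
    · subst h0; exact Iff.rfl
    · exact coord_pushCube_comp _ _ _ h0 (Or.inr (Or.inr hw))
  have h1 : ∀ x, coord ((f ≫ boxMap (φ ≫ ψ)).map x) (ψ.toOrderHom (φ.toOrderHom 0)) = true := by
    intro x
    by_cases h : ψ.toOrderHom (φ.toOrderHom 0) = 0
    · rw [h]; rfl
    · exact (coord_pushCube _ _ h).2 ⟨0, rfl, rfl⟩
  exact QRel.of_coord _ (fun w hw x => h0 w hw.le x) h1 fun x => (h0 _ le_rfl x).1 (h1 x)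

lemma boxMap_id (X : SimplexCategory) : boxMap (𝟙 X) = 𝟙 _ :=
  Box.hom_ext (pushCube_id X.len)

/-- The map `Q^m ⟶ Q^n` induced by a map `[m] → [n]` of the simplex category. -/
def qMap {X Y : SimplexCategory} (φ : X ⟶ Y) : qObj.{u} X.len ⟶ qObj.{u} Y.len where
  app a := ↾fun z =>
    ⟨Quotient.map (fun f => f ≫ boxMap φ) (fun _ _ r => QRel.postcomp φ r) z.down⟩
  naturality a b h := by
    ext ⟨z⟩
    induction z using Quotient.inductionOn
    rfl

/-- The cosimplicial object `[n] ↦ Q^n` of the category of cubical sets. -/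
def qCosimplicial : SimplexCategory ⥤ CSet.{u} where
  obj X := qObj X.len
  map φ := qMap φ
  map_id X := by
    ext a ⟨z⟩
    induction z using Quotient.inductionOn with
    | _ f =>
      exact congrArg (fun g => (⟨Quotient.mk (qSetoid a.unop ⟨X.len⟩) g⟩ : ULift.{u} _))
        ((congrArg (f ≫ ·) (boxMap_id X)).trans (Category.comp_id f))
  map_comp φ ψ := by
    ext a ⟨z⟩
    induction z using Quotient.inductionOn with
    | _ f => exact congrArg ULift.up.{u} (Quotient.sound (s := qSetoid _ _) (QRel.comp φ ψ f))

/-- The maps of the cosimplicial object are induced by the maps `boxMap φ` of cubes. -/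
lemma qProj_naturality {X Y : SimplexCategory} (φ : X ⟶ Y) :
    qProj.{u} X.len ≫ qCosimplicial.map φ = uliftYoneda.{u}.map (boxMap φ) ≫ qProj Y.len :=
  rfl

/-! ### The two functors -/

/-- The functor `∫ : cSet ⥤ sSet` with `(∫ X)_n = cSet(Q^n, X)`. -/
def integral : CSet.{u} ⥤ SSet.{u} :=
  Presheaf.restrictedULiftYoneda.{0} qCosimplicial.{u}

instance : SSet.stdSimplex.{u}.HasPointwiseLeftKanExtension qCosimplicial.{u} := inferInstance

instance : SSet.stdSimplex.{u}.HasLeftKanExtension qCosimplicial.{u} :=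
  @Functor.instHasLeftKanExtension _ _ _ _ _ _ SSet.stdSimplex.{u} qCosimplicial.{u} inferInstance

/-- The functor `Q : sSet ⥤ cSet`, the left Kan extension of `[n] ↦ Q^n` along the Yoneda
embedding `[n] ↦ Δ^n`. -/
noncomputable def qFunctor : SSet.{u} ⥤ CSet.{u} :=
  SSet.stdSimplex.{u}.leftKanExtension qCosimplicial.{u}

/-- The canonical map `Q^n ⟶ Q Δ^n` of the left Kan extension, natural in `[n]`. -/
noncomputable def qFunctorUnit : qCosimplicial.{u} ⟶ SSet.stdSimplex.{u} ⋙ qFunctor.{u} :=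
  SSet.stdSimplex.{u}.leftKanExtensionUnit qCosimplicial.{u}

instance qFunctor_isLeftKanExtension : qFunctor.{u}.IsLeftKanExtension qFunctorUnit.{u} :=
  Functor.instIsLeftKanExtensionLeftKanExtensionLeftKanExtensionUnit
    SSet.stdSimplex.{u} qCosimplicial.{u}

end CubicalCoreflection

namespace CubicalCoreflection

/-! ### The greatest vertex of a point of a cube -/

/-! A map `Q^n → Q X` amounts to an `n`-cube of `Q X`, the image of the class of the identity, that
respects `QRel`; the cubes of `Q X` are glued from cubes of the `Q^k` along the simplices of `X`.
The unit is invertible because such compatible cubes are exactly the simplices of `X`, and an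
invertible unit makes the left adjoint full and faithful.

Injectivity: `topVertex` maps the points of `[1]^k` to `[k]`, is blind to `QRel`, and commutes with
the cosimplicial maps. Evaluated along suitable points of `[1]^n`, it turns an `n`-cube of `Q^k`
into a monotone map `[n] → [k]`, naturally in `[k]`, and the identity cube into the identity
(`vertexMap`). This descends to a map from the `n`-cubes of `Q X` to `X_n` that inverts the unit on
the left.

Surjectivity: each coordinate of a box map is constantly `1` or a join of input coordinates, in an
order-preserving pattern (`IsBoxMap.exists_rel`). Hence for every cube `f` of `Q^k` there are
endomorphisms `s`, `t` of `[1]^n`, identified in `Q^n`, such that `s ≫ f` represents `f` and `t ≫ f`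
represents some `boxMap φ` (`exists_qRel_boxMap`). A map `c` out of `Q^n` cannot distinguish `s`
from `t`; so if its cube is `f` over a simplex `x`, then `c` is given by the restriction of `x`
along `φ`. -/

/-- The greatest vertex of `[n]` at which the coordinate of `x` is `1`. -/
def topVertex {n : ℕ} (x : Cube n) : Fin (n + 1) :=
  -- Vertex `0` always has coordinate `1`, so the set is nonempty and the least point has greatest
  -- vertex `0`.
  (Finset.univ.filter fun v => coord x v = true).max' ⟨0, by simp⟩

lemma coord_topVertex {n : ℕ} (x : Cube n) : coord x (topVertex x) = true :=
  (Finset.mem_filter.1 (Finset.max'_mem (Finset.univ.filter fun v => coord x v = true) _)).2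

lemma le_topVertex {n : ℕ} {x : Cube n} {v : Fin (n + 1)} (h : coord x v = true) :
    v ≤ topVertex x :=
  Finset.le_max' _ _ (by simpa using h)

lemma topVertex_eq {n : ℕ} {x : Cube n} {v : Fin (n + 1)} (h : coord x v = true)
    (h' : ∀ w, coord x w = true → w ≤ v) : topVertex x = v :=
  le_antisymm (h' _ (coord_topVertex x)) (le_topVertex h)

/-- `pushCube φ` takes joins over the fibres of `φ`, so away from `0` the vertices with coordinate
`1` are the images under `φ` of such vertices; a monotone map preserves the greatest one. -/
lemma topVertex_pushCube {m n : ℕ} (φ : Fin (m + 1) →o Fin (n + 1)) (x : Cube m) :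
    topVertex (pushCube φ x) = φ (topVertex x) := by
  refine topVertex_eq ?_ fun w hw => ?_
  · by_cases h : φ (topVertex x) = 0
    · rw [h]; rfl
    · exact (coord_pushCube _ _ h).2 ⟨_, rfl, coord_topVertex x⟩
  · by_cases h : w = 0
    · rw [h]; exact Fin.zero_le _
    · obtain ⟨u, rfl, hu⟩ := (coord_pushCube _ _ h).1 hw
      exact φ.monotone (le_topVertex hu)

/-- Two related cubes differ only at vertices below one where both are constantly `1`, and such
vertices are never greatest. -/
lemma QRel.topVertex_eq {a : Box} {n : ℕ} {f g : a ⟶ ⟨n⟩} (h : QRel f g) (x : Cube a.dim) :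
    topVertex (f.map x) = topVertex (g.map x) := by
  obtain rfl | ⟨j, e, hf, hg⟩ := h
  · rfl
  have key : ∀ {f g : a ⟶ ⟨n⟩}, (∀ i < j, ∀ x, f.map x i = g.map x i) →
      (∀ x, f.map x j = true) → (∀ x, g.map x j = true) →
      topVertex (f.map x) ≤ topVertex (g.map x) := by
    intro f g e hf hg
    rcases le_or_gt (topVertex (f.map x)) j.rev.succ with h | h
    · exact h.trans (le_topVertex (by simpa using hg x))
    · apply le_topVertex
      obtain ⟨v, hv⟩ := Fin.exists_succ_eq.2 (lt_of_le_of_lt (Fin.zero_le _) h).ne'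
      have := coord_topVertex (f.map x)
      rw [← hv] at this h ⊢
      rw [coord_succ] at this ⊢
      rwa [← e _ (Fin.rev_lt_iff.2 (Fin.succ_lt_succ_iff.1 h))]
  exact le_antisymm (key e hf hg) (key (fun i hi x => (e i hi x).symm) hg hf)

/-! ### A natural retraction -/

/-- The point of the cube `[1]^n` whose only coordinate with value `1` is the one at the
vertex `u`; this is the least point if `u = 0`. -/
def vertexCube {n : ℕ} (u : Fin (n + 1)) : Cube n := fun k => decide (k.rev.succ = u)

lemma coord_vertexCube {n : ℕ} (u v : Fin (n + 1)) :
    coord (vertexCube u) v = true ↔ v = 0 ∨ v = u := by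
  induction v using Fin.cases with
  | zero => simp
  | succ v => simp [vertexCube]

lemma topVertex_vertexCube {n : ℕ} (u : Fin (n + 1)) : topVertex (vertexCube u) = u := by
  refine topVertex_eq ((coord_vertexCube _ _).2 (Or.inr rfl)) fun w hw => ?_
  obtain rfl | rfl := (coord_vertexCube _ _).1 hw
  · exact Fin.zero_le _
  · exact le_rfl

/-- The monotone map `[n] → [k]` attached to a map of cubes `f`, which sends `u` to the minimum
of the greatest vertices of the values of `f` at the points `vertexCube v` for `v ≥ u`. -/
def vertexMap {n k : ℕ} (f : Cube n → Cube k) : Fin (n + 1) →o Fin (k + 1) where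
  -- For distinct `v ≠ 0` the points `vertexCube v` are incomparable, so their values under
  -- `topVertex ∘ f` need not increase with `v`. The minimum over the tail forces monotonicity.
  toFun u := (Finset.Ici u).inf' ⟨u, by simp⟩ fun v => topVertex (f (vertexCube v))
  monotone' _ _ h := Finset.inf'_mono _ (Finset.Ici_subset_Ici.2 h) _

lemma vertexMap_apply {n k : ℕ} (f : Cube n → Cube k) (u : Fin (n + 1)) :
    vertexMap f u =
      (Finset.Ici u).inf' ⟨u, by simp⟩ fun v => topVertex (f (vertexCube v)) := rfl

lemma vertexMap_congr {n k : ℕ} {f g : Cube n → Cube k}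
    (h : ∀ x, topVertex (f x) = topVertex (g x)) : vertexMap f = vertexMap g := by
  refine OrderHom.ext _ _ (funext fun u => ?_)
  simp only [vertexMap_apply, h]

lemma vertexMap_id (n : ℕ) : vertexMap (id : Cube n → Cube n) = OrderHom.id := by
  refine OrderHom.ext _ _ (funext fun u => ?_)
  rw [vertexMap_apply]
  refine le_antisymm ((Finset.inf'_le _ (Finset.mem_Ici.2 le_rfl)).trans_eq
    (topVertex_vertexCube u)) (Finset.le_inf' _ _ fun v hv => ?_)
  simpa [topVertex_vertexCube] using hv

/-- Monotone maps between linear orders commute with finite minima. -/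
lemma vertexMap_pushCube {n k l : ℕ} (φ : Fin (k + 1) →o Fin (l + 1)) (f : Cube n → Cube k) :
    vertexMap (fun x => pushCube φ (f x)) = φ.comp (vertexMap f) := by
  refine OrderHom.ext _ _ (funext fun u => ?_)
  rw [OrderHom.comp_coe, Function.comp_apply, vertexMap_apply, vertexMap_apply]
  simp only [topVertex_pushCube]
  refine le_antisymm ?_ (Finset.le_inf' _ _ fun v hv => φ.monotone (Finset.inf'_le _ hv))
  obtain ⟨v, hv, h⟩ := Finset.exists_mem_eq_inf' (s := Finset.Ici u) ⟨u, by simp⟩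
    fun v => topVertex (f (vertexCube v))
  exact (Finset.inf'_le _ hv).trans_eq (congrArg φ h.symm)

/-! ### The shape of the maps of the box category -/

/-- The generators have this form, and it is stable under composition. `T` marks the outputs forced
to be `1`, and `ρ` records which inputs are joined into which outputs; an empty join gives the
constant `0`. The order condition with `i = i'` says that an input feeds at most one output. -/
lemma IsBoxMap.exists_rel {m n : ℕ} {f : Cube m →o Cube n} (hf : IsBoxMap f) :
    ∃ (T : Fin n → Prop) (ρ : Fin m → Fin n → Prop),
      (∀ x k, f x k = true ↔ T k ∨ ∃ i, ρ i k ∧ x i = true) ∧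
      ∀ ⦃i i' k k'⦄, i ≤ i' → ρ i k → ρ i' k' → k ≤ k' := by
  induction hf with
  | id n =>
    exact ⟨fun _ => False, fun i k => i = k, by simp, by rintro i i' _ _ h rfl rfl; exact h⟩
  | @face n j ε =>
    refine ⟨fun k => k = j ∧ ε = true, fun i k => j.succAbove i = k, fun x k => ?_, ?_⟩
    · rw [face_apply]
      induction k using Fin.succAboveCases j with
      | x => simp [Fin.succAbove_ne]
      | p k => simp [Fin.succAbove_ne]
    · rintro i i' _ _ h rfl rfl
      exact (Fin.strictMono_succAbove j).monotone h
  | degeneracy j =>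
    refine ⟨fun _ => False, fun i k => j.succAbove k = i, fun x k => ?_, ?_⟩
    · simp [degeneracy_apply]
    · rintro _ _ k k' h rfl rfl
      exact (Fin.strictMono_succAbove j).le_iff_le.1 h
  | connection j =>
    refine ⟨fun _ => False, fun i k => j.predAbove i = k, fun x k => ?_, ?_⟩
    · simp [connection_apply]
    · rintro i i' _ _ h rfl rfl
      exact Fin.predAbove_right_monotone j h
  | @comp l m n g f _ _ ihg ihf =>
    obtain ⟨T, ρ, hf, hρ⟩ := ihf
    obtain ⟨T', ρ', hg, hρ'⟩ := ihg
    refine ⟨fun k => T' k ∨ ∃ j, ρ' j k ∧ T j, fun i k => ∃ j, ρ i j ∧ ρ' j k, fun x k => ?_, ?_⟩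
    · rw [OrderHom.comp_coe, Function.comp_apply, hg]
      simp only [hf]
      grind
    · rintro i i' k k' h ⟨j, h₁, h₂⟩ ⟨j', h₁', h₂'⟩
      exact hρ' (hρ h h₁ h₁') h₂ h₂'

/-- Reformulation of `IsBoxMap.exists_rel` in terms of the coordinates at vertices. -/
lemma IsBoxMap.exists_coord_rel {m n : ℕ} {f : Cube m →o Cube n} (hf : IsBoxMap f) :
    ∃ (T : Fin (n + 1) → Prop) (ρ : Fin (m + 1) → Fin (n + 1) → Prop), T 0 ∧
      (∀ x v, coord (f x) v = true ↔ T v ∨ ∃ u ≠ 0, ρ u v ∧ coord x u = true) ∧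
      ∀ ⦃u u' v v'⦄, u ≤ u' → ρ u v → ρ u' v' → v ≤ v' := by
  obtain ⟨T, ρ, h, hρ⟩ := hf.exists_rel
  refine ⟨Fin.cases (motive := fun _ => Prop) True fun v => T v.rev,
    fun u v => ∃ i j, u = i.rev.succ ∧ v = j.rev.succ ∧ ρ i j, trivial, fun x v => ?_, ?_⟩
  · induction v using Fin.cases with
    | zero => simp
    | succ v =>
      rw [coord_succ, h]
      refine or_congr Iff.rfl ⟨?_, ?_⟩
      · rintro ⟨i, hi, hx⟩
        exact ⟨i.rev.succ, Fin.succ_ne_zero _, ⟨i, v.rev, rfl, by simp, hi⟩, by simpa using hx⟩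
      · rintro ⟨_, _, ⟨i, j, rfl, e, hi⟩, hx⟩
        obtain rfl : v = j.rev := Fin.succ_injective _ e
        exact ⟨i, by simpa using hi, by simpa using hx⟩
  · rintro _ _ _ _ huu ⟨i, j, rfl, rfl, h₁⟩ ⟨i', j', rfl, rfl, h₂⟩
    simp only [Fin.succ_le_succ_iff, Fin.rev_le_rev] at huu ⊢
    exact hρ huu h₂ h₁

/-! ### Cubes that respect the relation -/

/-- The endomorphism of `[1]^n` that sets the coordinate at the vertex `u` to `1`. -/
lemma exists_setCoord {n : ℕ} (u : Fin (n + 1)) : ∃ s : (⟨n⟩ : Box) ⟶ ⟨n⟩,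
    ∀ x v, coord (s.map x) v = true ↔ v = u ∨ coord x v = true := by
  induction u using Fin.cases with
  -- Coordinate `0` is already `1` by convention, so the identity works.
  | zero =>
    refine ⟨𝟙 _, fun x v => ?_⟩
    by_cases h : v = 0
    · simp [h]
    · simp [h]
  | succ i =>
    obtain _ | n := n
    · exact i.elim0
    refine ⟨⟨(face i.rev true).comp (degeneracy i.rev), .comp (.face _ _) (.degeneracy _)⟩,
      fun x v => ?_⟩
    induction v using Fin.cases with
    | zero => simp
    | succ v =>
      change face i.rev true (degeneracy i.rev x) v.rev = true ↔ _ ∨ x v.rev = true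
      rw [face_apply, Fin.succ_inj, ← Fin.rev_inj]
      induction v.rev using Fin.succAboveCases i.rev with
      | x => simp
      | p k => simp [degeneracy_apply, Fin.succAbove_ne]

/-- The monotone map that sends all vertices `≤ u` to `u`. -/
def collapse {n : ℕ} (u : Fin (n + 1)) :
    SimplexCategory.mk n ⟶ SimplexCategory.mk n :=
  SimplexCategory.Hom.mk ⟨fun v => max u v, fun _ _ h => max_le_max le_rfl h⟩

lemma coord_boxMap_collapse {n : ℕ} (u v : Fin (n + 1)) (x : Cube n) :
    coord ((boxMap (collapse u)).map x) v = true ↔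
      v = 0 ∨ v = u ∨ (u < v ∧ coord x v = true) := by
  by_cases h : v = 0
  · simp [h]
  refine (coord_pushCube _ _ h).trans ?_
  change (∃ w, max u w = v ∧ _) ↔ _
  constructor
  · rintro ⟨w, rfl, hw⟩
    rcases le_or_gt w u with h' | h'
    · simp [h']
    · simp [h', h'.le, hw]
  · rintro (h' | rfl | ⟨h', hx⟩)
    · exact absurd h' h
    · exact ⟨0, by simp, rfl⟩
    · exact ⟨v, max_eq_right h'.le, hx⟩

/-- A cube of `Q^k` becomes the cube given by a map of simplices when it is restricted along
the two endomorphisms of `[1]^n` that are identified in `Q^n`. -/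
lemma exists_qRel_boxMap {n k : ℕ} (f : (⟨n⟩ : Box) ⟶ ⟨k⟩) :
    ∃ (s t : (⟨n⟩ : Box) ⟶ ⟨n⟩) (φ : SimplexCategory.mk n ⟶ SimplexCategory.mk k),
      QRel s t ∧ QRel (s ≫ f) f ∧ QRel (t ≫ f) (boxMap φ) := by
  obtain ⟨T, ρ, hT, hf, hρ⟩ := f.isBoxMap.exists_coord_rel
  have hw := coord_topVertex (f.map (vertexCube 0))
  have hw' : ∀ v, T v → v ≤ topVertex (f.map (vertexCube 0)) :=
    fun v hv => le_topVertex ((hf _ _).2 (Or.inl hv))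
  set w := topVertex (f.map (vertexCube 0)) with hw_def
  -- At the least point no input contributes, so `w` is the greatest vertex at which `f` is
  -- constantly `1`. In `Q^k` only the coordinates above `w` matter.
  replace hw : T w := by
    rcases (hf _ _).1 hw with h | ⟨u, hu, -, h⟩
    · exact h
    · exact absurd (by simpa [coord_vertexCube] using h) hu
  have hwf : ∀ x, coord (f.map x) w = true := fun x => (hf x w).2 (Or.inl hw)
  have hlt : ∀ x v, w < v → (coord (f.map x) v = true ↔ ∃ u ≠ 0, ρ u v ∧ coord x u = true) :=
    fun x v hv => (hf x v).trans (or_iff_right fun h => absurd (hw' v h) (not_le.2 hv))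
  -- `u` is the greatest vertex that feeds nothing above `w`, or `0` if there is none.
  obtain ⟨u, hu, hmax⟩ : ∃ u : Fin (n + 1), (u = 0 ∨ ∀ v, w < v → ¬ ρ u v) ∧
      ∀ u', u < u' → ∃ v, w < v ∧ ρ u' v := by
    classical
    have hne : (Finset.univ.filter fun u : Fin (n + 1) =>
      u = 0 ∨ ∀ v, w < v → ¬ ρ u v).Nonempty := ⟨0, by simp⟩
    refine ⟨_, (Finset.mem_filter.1 (Finset.max'_mem _ hne)).2, fun u' hu' => ?_⟩
    by_contra! h
    exact absurd (Finset.le_max' _ u' (by simpa using Or.inr h)) (not_le.2 hu')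
  choose q hq using fun u' : {u' // u < u'} => hmax u'.1 u'.2
  -- The order condition on `ρ`, used in both directions, makes the output fed by `u'` unique.
  have hq' : ∀ u' v, ρ u'.1 v → v = q u' := fun u' v h =>
    le_antisymm (hρ le_rfl h (hq u').2) (hρ le_rfl (hq u').2 h)
  -- Vertices above `u` go to the output they feed; all others go to `w`, where the coordinate is
  -- `1` anyway.
  let φ : Fin (n + 1) →o Fin (k + 1) :=
    { toFun := fun u' => if h : u < u' then q ⟨u', h⟩ else w
      monotone' := by
        intro a b hab
        dsimp only
        split_ifs with h₁ h₂ h₂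
        · exact hρ hab (hq ⟨a, h₁⟩).2 (hq ⟨b, h₂⟩).2
        · exact absurd (h₁.trans_le hab) h₂
        · exact (hq _).1.le
        · exact le_rfl }
  have hφ : ∀ u', ¬ u < u' → φ u' = w := fun _ h => dif_neg h
  obtain ⟨s, hs⟩ := exists_setCoord u
  refine ⟨s, boxMap (collapse u), SimplexCategory.Hom.mk φ, ?_, ?_, ?_⟩
  -- Both maps put `1` at `u` and change nothing above `u`; they may differ only below `u`, where
  -- `Q^n` does not see it.
  · refine QRel.of_coord u (fun v hv x => ?_) (fun x => (hs _ _).2 (Or.inl rfl))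
      (fun x => (coord_boxMap_collapse _ _ _).2 (Or.inr (Or.inl rfl)))
    rw [hs, coord_boxMap_collapse]
    simp [hv.ne', hv, (lt_of_le_of_lt (Fin.zero_le _) hv).ne']
  · refine QRel.of_coord w (fun v hv x => ?_) (fun x => hwf _) hwf
    change coord (f.map (s.map x)) v = true ↔ _
    rw [hlt _ _ hv, hlt _ _ hv]
    simp only [hs]
    refine exists_congr fun u' => and_congr_right fun h0 => and_congr_right fun h => ?_
    refine or_iff_right ?_
    rintro rfl
    -- Setting the coordinate at `u` to `1` is invisible above `w`, by the choice of `u`.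
    exact hu.elim h0 fun hu => hu v hv h
  · have h0 : ∀ v, w < v → v ≠ 0 := fun v hv => (lt_of_le_of_lt (Fin.zero_le _) hv).ne'
    refine QRel.of_coord w (fun v hv x => ?_) (fun x => hwf _) (fun x => ?_)
    · refine Iff.trans ?_ (coord_pushCube _ _ (h0 v hv)).symm
      change coord (f.map ((boxMap (collapse u)).map x)) v = true ↔ ∃ u', φ u' = v ∧ _
      rw [hlt _ _ hv]
      refine exists_congr fun u' => ?_
      rw [coord_boxMap_collapse u u' x]
      by_cases h : u < u'
      · have : φ u' = q ⟨u', h⟩ := dif_pos h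
        have hu0 : u' ≠ 0 := (lt_of_le_of_lt (Fin.zero_le _) h).ne'
        simp only [this, hu0, h, h.ne', ne_eq, not_false_eq_true, true_and, false_or]
        refine and_congr_left fun _ => ⟨fun h' => (hq' _ _ h').symm, ?_⟩
        rintro rfl
        exact (hq ⟨u', h⟩).2
      -- Below `u` the collapse erases all inputs except the convention at `0`, and `u` itself feeds
      -- nothing above `w`.
      · simp only [hφ u' h, hv.ne, h, false_and, or_false, iff_false, not_and]
        rintro hu0 h₁ (h₂ | rfl)
        · exact hu0 h₂
        · exact hu.elim hu0 fun hu => hu v hv h₁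
    · by_cases hw0 : w = 0
      · rw [hw0]; rfl
      · exact (coord_pushCube _ _ hw0).2 ⟨0, hφ 0 (Fin.zero_le u).not_gt, rfl⟩

open Limits

/-! ### Cubes of the left Kan extension -/

section LeftKanExtension

variable (L : (SimplexCategoryᵒᵖ ⥤ Type u) ⥤ CSet.{u})
  (α : qCosimplicial.{u} ⟶ uliftYoneda.{u} ⋙ L)

/-- The map `Q^n ⟶ L X` given by an `n`-simplex of `X`, where `L` is equipped with maps from
`Q^n` to the value at the `n`-th representable presheaf. -/
def simplexMap (X : SimplexCategoryᵒᵖ ⥤ Type u) {n : SimplexCategory} (x : X.obj (op n)) :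
    qCosimplicial.{u}.obj n ⟶ L.obj X :=
  α.app n ≫ L.map (uliftYonedaEquiv.symm x)

variable {L}

lemma qMap_simplexMap (X : SimplexCategoryᵒᵖ ⥤ Type u) {m n : SimplexCategory} (φ : m ⟶ n)
    (x : X.obj (op n)) :
    qCosimplicial.map φ ≫ simplexMap L α X x = simplexMap L α X (X.map φ.op x) := by
  rw [simplexMap, simplexMap, uliftYonedaEquiv_symm_map, Functor.map_comp]
  exact α.naturality_assoc φ _

/-- The cube of `Q^n` represented by a map of the box category. -/
def qMk {a : Box} {n : SimplexCategory} (f : a ⟶ ⟨n.len⟩) :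
    (qCosimplicial.{u}.obj n).obj (op a) :=
  ⟨Quotient.mk (qSetoid a ⟨n.len⟩) f⟩

lemma qMk_eq {a : Box} {n : SimplexCategory} {f g : a ⟶ ⟨n.len⟩} (h : QRel f g) :
    qMk.{u} f = qMk g :=
  congrArg ULift.up (Quotient.sound (s := qSetoid _ _) h)

lemma qMk_surjective {a : Box} {n : SimplexCategory}
    (z : (qCosimplicial.{u}.obj n).obj (op a)) : ∃ f, z = qMk f := by
  obtain ⟨z⟩ := z
  induction z using Quotient.inductionOn with
  | _ f => exact ⟨f, rfl⟩

/-- The natural map from the `n`-cubes of `Q^k` to the monotone maps `[n] → [k]`. -/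
def qVertexMap {n k : SimplexCategory} (z : (qCosimplicial.{u}.obj k).obj (op ⟨n.len⟩)) :
    n ⟶ k :=
  SimplexCategory.Hom.mk (Quotient.lift (s := qSetoid _ _) (fun f => vertexMap f.map)
    (fun _ _ h => vertexMap_congr (QRel.topVertex_eq h)) z.down)

/-- Naturality in `k` with `n` fixed is all that the gluing along simplices requires. -/
lemma qVertexMap_map {n k l : SimplexCategory} (φ : k ⟶ l)
    (z : (qCosimplicial.{u}.obj k).obj (op ⟨n.len⟩)) :
    qVertexMap ((qCosimplicial.{u}.map φ).app (op ⟨n.len⟩) z) = qVertexMap z ≫ φ := by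
  obtain ⟨f, rfl⟩ := qMk_surjective z
  exact SimplexCategory.Hom.ext _ _ (vertexMap_pushCube φ.toOrderHom f.map)

lemma qVertexMap_qMk_id (n : SimplexCategory) : qVertexMap (qMk.{u} (n := n) (𝟙 (⟨n.len⟩ : Box))) = 𝟙 n :=
  SimplexCategory.Hom.ext _ _ (vertexMap_id n.len)

lemma map_qVertexMap_map (X : SimplexCategoryᵒᵖ ⥤ Type u) {n k l : SimplexCategory} (φ : k ⟶ l)
    (x : uliftYoneda.{u}.obj l ⟶ X) (z : (qCosimplicial.{u}.obj k).obj (op ⟨n.len⟩)) :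
    X.map (qVertexMap ((qCosimplicial.{u}.map φ).app (op ⟨n.len⟩) z)).op (uliftYonedaEquiv x) =
      X.map (qVertexMap z).op (uliftYonedaEquiv (uliftYoneda.{u}.map φ ≫ x)) := by
  rw [qVertexMap_map, ← φ.unop_op, ← uliftYonedaEquiv_naturality, op_comp, Functor.map_comp]
  rfl

/-! ### Cubes of `L X` as a colimit, and bijectivity of the unit -/

variable [L.IsLeftKanExtension α]

/-- The colimit cocone that computes the `a`-cubes of `L X`. -/
noncomputable def isColimitCubes (X : SimplexCategoryᵒᵖ ⥤ Type u) (a : Box) :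
    IsColimit (((evaluation Boxᵒᵖ (Type u)).obj (op a)).mapCocone
      ((Functor.LeftExtension.mk L α).coconeAt X)) :=
  isColimitOfPreserves _ (Functor.isPointwiseLeftKanExtensionOfIsLeftKanExtension L α X)

lemma exists_simplexMap (X : SimplexCategoryᵒᵖ ⥤ Type u) {a : Box} (c : (L.obj X).obj (op a)) :
    ∃ (k : SimplexCategory) (x : X.obj (op k)) (f : a ⟶ ⟨k.len⟩),
      (simplexMap L α X x).app (op a) (qMk f) = c := by
  obtain ⟨j, z, hz⟩ := Types.jointly_surjective_of_isColimit (isColimitCubes α X a) c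
  obtain ⟨f, rfl⟩ := qMk_surjective (n := j.left) z
  refine ⟨j.left, uliftYonedaEquiv j.hom, f, Eq.trans ?_ hz⟩
  rw [simplexMap, Equiv.symm_apply_apply]
  rfl

/-- The cocone that sends a cube `z` of `Q^k` over a simplex `x` to the restriction of `x`
along `qVertexMap z`. -/
def vertexMapCocone (X : SimplexCategoryᵒᵖ ⥤ Type u) (n : SimplexCategory) :
    Cocone ((CostructuredArrow.proj uliftYoneda.{u} X ⋙ qCosimplicial.{u}) ⋙
      (evaluation Boxᵒᵖ (Type u)).obj (op ⟨n.len⟩)) where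
  pt := X.obj (op n)
  ι :=
    { app j := ↾fun z => X.map (qVertexMap (k := j.left) z).op (uliftYonedaEquiv j.hom)
      naturality i j φ := by
        ext z
        refine (map_qVertexMap_map X φ.left j.hom z).trans ?_
        rw [CostructuredArrow.w φ]
        rfl }

/-- The left inverse evaluates a map at the class of the identity and applies the map to `X_n`
induced by `vertexMapCocone`. It returns `x` because `qVertexMap` sends that class to the identity.
-/
lemma simplexMap_injective (X : SimplexCategoryᵒᵖ ⥤ Type u) (n : SimplexCategory) :
    Function.Injective (simplexMap L α X (n := n)) := by
  refine Function.LeftInverse.injective (g := fun c =>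
    (isColimitCubes α X ⟨n.len⟩).desc (vertexMapCocone X n) (c.app _ (qMk (𝟙 _)))) fun x => ?_
  refine (ConcreteCategory.congr_hom ((isColimitCubes α X ⟨n.len⟩).fac (vertexMapCocone X n)
    (CostructuredArrow.mk (uliftYonedaEquiv.symm x))) (qMk (𝟙 _))).trans ?_
  change X.map (qVertexMap (qMk (𝟙 _))).op (uliftYonedaEquiv (uliftYonedaEquiv.symm x)) = x
  rw [qVertexMap_qMk_id]
  exact (ConcreteCategory.congr_hom (X.map_id _) _).trans (uliftYonedaEquiv.apply_symm_apply x)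

/-- The cube of `c` lifts to some `f` over a simplex `x`; since `c` respects `QRel`, `f` may be
traded for a cube of the form `boxMap φ`. -/
lemma simplexMap_surjective (X : SimplexCategoryᵒᵖ ⥤ Type u) (n : SimplexCategory) :
    Function.Surjective (simplexMap L α X (n := n)) := by
  intro c
  obtain ⟨k, x, f, hc⟩ := exists_simplexMap α X (c.app (op ⟨n.len⟩) (qMk (𝟙 _)))
  obtain ⟨s, t, φ, hst, hs, ht⟩ := exists_qRel_boxMap f
  have nat : ∀ {m : SimplexCategory} (d : qCosimplicial.{u}.obj m ⟶ L.obj X)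
      {a b : Box} (h : a ⟶ b) (g : b ⟶ ⟨m.len⟩),
      d.app (op a) (qMk (h ≫ g)) = (L.obj X).map h.op (d.app (op b) (qMk g)) :=
    fun d _ _ h g => NatTrans.naturality_apply d h.op (qMk g)
  -- The class of the identity generates `Q^n`, as in the Yoneda lemma.
  have ext : ∀ {d : qCosimplicial.{u}.obj n ⟶ L.obj X},
      d.app (op ⟨n.len⟩) (qMk (𝟙 _)) = c.app (op ⟨n.len⟩) (qMk (𝟙 _)) → d = c := by
    intro d h
    ext ⟨a⟩ z
    obtain ⟨g, rfl⟩ := qMk_surjective (n := n) z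
    rw [← Category.comp_id g]
    exact (nat d g _).trans ((congrArg _ h).trans (nat c g _).symm)
  refine ⟨X.map φ.op x, ext ?_⟩
  rw [← qMap_simplexMap]
  change (simplexMap L α X x).app _ (qMk (𝟙 _ ≫ boxMap φ)) = _
  -- The relation between `t` and `s` is used in `Q^n`, the source of `c`; the other two are used in
  -- `Q^k`, the source of the map given by `x`.
  calc (simplexMap L α X x).app _ (qMk (𝟙 _ ≫ boxMap φ))
      = (simplexMap L α X x).app _ (qMk (t ≫ f)) := by rw [Category.id_comp, qMk_eq ht]
    _ = c.app _ (qMk (t ≫ 𝟙 _)) := by rw [nat, nat, hc]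
    _ = c.app _ (qMk (s ≫ 𝟙 _)) := by
        rw [Category.comp_id, Category.comp_id, qMk_eq hst]
    _ = (simplexMap L α X x).app _ (qMk (s ≫ f)) := by rw [nat, nat, hc]
    _ = c.app _ (qMk (𝟙 _)) := by rw [qMk_eq hs, hc]

theorem exists_adjunction_isIso_unit :
    ∃ adj : L ⊣ integral.{u},
      (∀ (X : SimplexCategoryᵒᵖ ⥤ Type u) (n : SimplexCategory) (x : X.obj (op n)),
        ((adj.unit.app X).app (op n) x).down = simplexMap L α X x) ∧
      (∀ X, IsIso (adj.unit.app X)) ∧ L.Full ∧ L.Faithful := by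
  let adj : L ⊣ integral.{u} := Presheaf.uliftYonedaAdjunction.{0} L α
  have unit_eq : ∀ (X : SimplexCategoryᵒᵖ ⥤ Type u) (n : SimplexCategory) (x : X.obj (op n)),
      (adj.unit.app X).app (op n) x = ULift.up (simplexMap L α X x) :=
    fun X n x => Presheaf.uliftYonedaAdjunction_unit_app_app.{0} L α X x
  have iso : ∀ X, IsIso (adj.unit.app X) := by
    intro X
    have : ∀ n, IsIso ((adj.unit.app X).app n) := by
      rintro ⟨n⟩
      refine (isIso_iff_bijective _).2 ⟨fun x y h => simplexMap_injective α X n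
        (ULift.up_injective ((unit_eq X n x).symm.trans (h.trans (unit_eq X n y)))), ?_⟩
      rintro ⟨c⟩
      obtain ⟨x, rfl⟩ := simplexMap_surjective α X n c
      exact ⟨x, unit_eq X n x⟩
    exact NatIso.isIso_of_isIso_app _
  have : IsIso adj.unit := NatIso.isIso_of_isIso_app _
  exact ⟨adj, fun X n x => congrArg ULift.down (unit_eq X n x), iso,
    adj.fullyFaithfulLOfIsIsoUnit.full, adj.fullyFaithfulLOfIsIsoUnit.faithful⟩

end LeftKanExtension

end CubicalCoreflection

theorem theorem3 :
    ∃ adj : CubicalCoreflection.qFunctor.{u} ⊣ CubicalCoreflection.integral.{u},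
      (∀ (X : SSet.{u}) (n : ℕ) (x : X.obj (op (SimplexCategory.mk n))),
        ((adj.unit.app X).app (op (SimplexCategory.mk n)) x).down =
          CubicalCoreflection.qFunctorUnit.app (SimplexCategory.mk n) ≫
            CubicalCoreflection.qFunctor.map (SSet.yonedaEquiv.symm x)) ∧
      (∀ X : SSet.{u}, IsIso (adj.unit.app X)) ∧
      CubicalCoreflection.qFunctor.{u}.Full ∧
      CubicalCoreflection.qFunctor.{u}.Faithful := by
  -- `SSet.stdSimplex` and `SSet.yonedaEquiv` agree definitionally with `uliftYoneda` and
  -- `uliftYonedaEquiv`, so the result for an arbitrary left Kan extension applies.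
  obtain ⟨adj, h₁, h₂⟩ := @CubicalCoreflection.exists_adjunction_isIso_unit.{u}
    CubicalCoreflection.qFunctor.{u} CubicalCoreflection.qFunctorUnit.{u}
    CubicalCoreflection.qFunctor_isLeftKanExtension.{u}
  exact ⟨adj, fun X n x => h₁ X _ x, h₂⟩
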